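/- Let $c,\tau\in(0,\infty)$ and consider causal diffusion in $\mathbb{R}^2$: for an initial concentration $u$, set $v_{c,\tau}(\cdot,0)=u$ and, for $t>0$, $$v_{c,\tau}(\mathbf{x},t)=\frac{1}{2\pi}\int_{S_1(0)} v_{c,\tau}\bigl(\mathbf{x}+R(t)\,\mathbf{y},\,n(t)\,\tau\bigr)\,d\sigma(\mathbf{y}),$$ where $n(t)\in\mathbb{N}_0$ is such that $t\in(n(t)\tau,(n(t)+1)\tau]$, $R(t)=c\,(t-n(t)\tau)$, and $\sigma$ is the arc length measure on the unit circle $S_1(0)$. The Green function $G_{c,\tau}(\cdot,t)$ is the measure on $\mathbb{R}^2$ obtained in the same way from the initial distribution $u=\delta$ (the unit mass at $0$), where the mean of a measure $\mu$ over circles of radius $R$ is the measure $A\mapsto \frac{1}{2\pi}\int_{S_1(0)}\mu(A+R\,\mathbf{y})\,d\sigma(\mathbf{y})$. Let $T>2\tau$. Then: 1. $G_{c,\tau}(\cdot,T)\in L^2_c(\mathbb{R}^2)$, i.e. the measure $G_{c,\tau}(\cdot,T)$ has a non-negative Lebesgue density that is square integrable and has compact support; this density is again denoted by $G_{c,\tau}(\cdot,T)$.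 2. Let $r>0$, let $\Omega_0$ be an open subset of the open ball $B_r(0)$, and put $\Omega_T:=B_{r+cT}(0)$. The forward operator $F_T:L^2(\Omega_0)\to L^2(\Omega_T)$, $u\mapsto v_{c,\tau}(\cdot,T)$ (with $u$ extended by $0$ outside $\Omega_0$; the function $v_{c,\tau}(\cdot,T)$ then vanishes almost everywhere outside $\Omega_T$), is a well-defined bounded linear operator. It is the Hilbert–Schmidt integral operator $$(F_Tu)(\mathbf{x})=\int_{\Omega_0}G_{c,\tau}(\mathbf{x}-\mathbf{x}',T)\,u(\mathbf{x}')\,d\mathbf{x}'\quad\text{for almost every }\mathbf{x}\in\Omega_T,$$ whose kernel $(\mathbf{x},\mathbf{x}')\mapsto G_{c,\tau}(\mathbf{x}-\mathbf{x}',T)$ is square integrable on $\Omega_T\times\Omega_0$, and it is compact. Here $L^2$ may be taken over the real or over the complex numbers. -/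

import Mathlib

open MeasureTheory Metric
open scoped ENNReal

noncomputable section

/-- `ℝ^N` with its Euclidean norm. -/
abbrev Space (N : ℕ) : Type := EuclideanSpace ℝ (Fin N)

/-- The surface measure of the unit sphere of `ℝ^N`, divided by the total surface area. -/
def sphereUniform (N : ℕ) : Measure (sphere (0 : Space N) 1) :=
  ((volume : Measure (Space N)).toSphere Set.univ)⁻¹ • (volume : Measure (Space N)).toSphere

/-- The mean value of `f` over the sphere with centre `x` and radius `R`. -/
def sphereMean {N : ℕ} {𝕜 : Type*} [RCLike 𝕜] (R : ℝ) (f : Space N → 𝕜) (x : Space N) : 𝕜 :=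
  ∫ y, f (x + R • (y : Space N)) ∂(sphereUniform N)

/-- The same averaging for a mass distribution `μ` instead of a density: the mass of a set `A`
becomes the mean over unit vectors `y` of `μ (A + R • y)`.  On absolutely continuous measures this
is the spherical mean of the density, see `sphereMeanMeasure_withDensity`. -/
def sphereMeanMeasure {N : ℕ} (R : ℝ) (μ : Measure (Space N)) : Measure (Space N) :=
  (μ.prod (sphereUniform N)).map fun p => p.1 - R • (p.2 : Space N)

/-- The index `n` with `t ∈ (n τ, (n + 1) τ]`, for `t > 0` and `τ > 0`. -/
def stepIndex (τ t : ℝ) : ℕ := ⌈t / τ⌉₊ - 1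

/-- The radius `R(t) = c (t - n(t) τ)`. -/
def stepRadius (c τ t : ℝ) : ℝ := c * (t - stepIndex τ t * τ)

/-- Causal diffusion at the time `n τ`, with initial concentration `u`. -/
def diffusionStep {N : ℕ} {𝕜 : Type*} [RCLike 𝕜] (c τ : ℝ) (u : Space N → 𝕜) :
    ℕ → Space N → 𝕜
  | 0 => u
  | n + 1 => sphereMean (c * τ) (diffusionStep c τ u n)

/-- Causal diffusion `v_{c,τ}(·, t)` with initial concentration `u`; the defining equations are
`causalDiffusion_zero` and `causalDiffusion_eq`. -/
def causalDiffusion {N : ℕ} {𝕜 : Type*} [RCLike 𝕜] (c τ : ℝ) (u : Space N → 𝕜) (t : ℝ) :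
    Space N → 𝕜 :=
  if t ≤ 0 then u else sphereMean (stepRadius c τ t) (diffusionStep c τ u (stepIndex τ t))

/-- Causal diffusion of an initial mass distribution at the time `n τ`. -/
def diffusionStepMeasure {N : ℕ} (c τ : ℝ) (μ : Measure (Space N)) : ℕ → Measure (Space N)
  | 0 => μ
  | n + 1 => sphereMeanMeasure (c * τ) (diffusionStepMeasure c τ μ n)

/-- Causal diffusion at time `t` of an initial mass distribution `μ`. -/
def causalDiffusionMeasure {N : ℕ} (c τ : ℝ) (μ : Measure (Space N)) (t : ℝ) :
    Measure (Space N) :=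
  if t ≤ 0 then μ
  else sphereMeanMeasure (stepRadius c τ t) (diffusionStepMeasure c τ μ (stepIndex τ t))

/-- The Green function `G_{c,τ}(·, t)`: causal diffusion started from the delta distribution. -/
def greenMeasure (N : ℕ) (c τ t : ℝ) : Measure (Space N) :=
  causalDiffusionMeasure c τ (Measure.dirac 0) t

/-- Square integrable functions with compact support. -/
def MemL2c {N : ℕ} (g : Space N → ℝ) : Prop :=
  MemLp g 2 volume ∧ HasCompactSupport g

theorem stepIndex_spec {τ t : ℝ} (hτ : 0 < τ) (ht : 0 < t) :
    t ∈ Set.Ioc (stepIndex τ t * τ) ((stepIndex τ t + 1 : ℝ) * τ) := by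
  have hp : 0 < ⌈t / τ⌉₊ := Nat.ceil_pos.2 (div_pos ht hτ)
  have h1 : ((stepIndex τ t : ℕ) : ℝ) + 1 = (⌈t / τ⌉₊ : ℝ) := by
    have : stepIndex τ t + 1 = ⌈t / τ⌉₊ := by unfold stepIndex; omega
    exact_mod_cast this
  constructor
  · have := Nat.ceil_lt_add_one (div_pos ht hτ).le
    rw [← lt_div_iff₀ hτ]; linarith
  · rw [h1, ← div_le_iff₀ hτ]; exact Nat.le_ceil _

theorem stepIndex_succ_mul {τ : ℝ} (hτ : 0 < τ) (n : ℕ) :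
    stepIndex τ (((n + 1 : ℕ) : ℝ) * τ) = n := by
  unfold stepIndex
  rw [mul_div_cancel_right₀ _ hτ.ne', Nat.ceil_natCast]; rfl

theorem causalDiffusion_zero {N : ℕ} {𝕜 : Type*} [RCLike 𝕜] (c τ : ℝ) (u : Space N → 𝕜) :
    causalDiffusion c τ u 0 = u := by
  simp [causalDiffusion]

theorem causalDiffusion_natCast_mul {N : ℕ} {𝕜 : Type*} [RCLike 𝕜] (c : ℝ) {τ : ℝ} (hτ : 0 < τ)
    (u : Space N → 𝕜) (n : ℕ) :
    causalDiffusion c τ u (n * τ) = diffusionStep c τ u n := by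
  cases n with
  | zero => simp [causalDiffusion, diffusionStep]
  | succ n =>
    have hpos : ¬ (((n + 1 : ℕ) : ℝ) * τ ≤ 0) := not_le.2 (by positivity)
    have hR : stepRadius c τ (((n + 1 : ℕ) : ℝ) * τ) = c * τ := by
      rw [stepRadius, stepIndex_succ_mul hτ]; push_cast; ring
    rw [causalDiffusion, if_neg hpos, hR, stepIndex_succ_mul hτ]; rfl

theorem causalDiffusion_eq {N : ℕ} {𝕜 : Type*} [RCLike 𝕜] (c : ℝ) {τ t : ℝ} (hτ : 0 < τ)
    (ht : 0 < t) (u : Space N → 𝕜) (x : Space N) :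
    causalDiffusion c τ u t x =
      ∫ y, causalDiffusion c τ u (stepIndex τ t * τ) (x + stepRadius c τ t • (y : Space N))
        ∂(sphereUniform N) := by
  rw [causalDiffusion_natCast_mul c hτ, causalDiffusion, if_neg (not_le.2 ht)]; rfl

instance (N : ℕ) : IsFiniteMeasure (sphereUniform N) := by
  refine ⟨?_⟩
  rw [sphereUniform, Measure.smul_apply, smul_eq_mul]
  exact (ENNReal.inv_mul_le_one _).trans_lt ENNReal.one_lt_top

theorem sphereMeanMeasure_withDensity {N : ℕ} (R : ℝ) {f : Space N → ℝ≥0∞} (hf : Measurable f) :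
    sphereMeanMeasure R (volume.withDensity f) =
      volume.withDensity fun x => ∫⁻ y, f (x + R • (y : Space N)) ∂(sphereUniform N) := by
  have hm : Measurable fun p : Space N × sphere (0 : Space N) 1 => p.1 - R • (p.2 : Space N) := by
    fun_prop
  have hg : Measurable fun p : Space N × sphere (0 : Space N) 1 => f (p.1 + R • (p.2 : Space N)) :=
    hf.comp (by fun_prop)
  ext A hA
  rw [sphereMeanMeasure, Measure.map_apply hm hA, Measure.prod_apply_symm (hm hA),
    withDensity_apply _ hA, lintegral_lintegral_swap hg.aemeasurable]
  refine lintegral_congr fun y => ?_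
  have hs : MeasurableSet ((fun x : Space N => x - R • (y : Space N)) ⁻¹' A) :=
    (measurable_id.sub_const _) hA
  have hpre : (fun x : Space N => (x, y)) ⁻¹'
      ((fun p : Space N × sphere (0 : Space N) 1 => p.1 - R • (p.2 : Space N)) ⁻¹' A) =
      (fun x : Space N => x - R • (y : Space N)) ⁻¹' A := rfl
  rw [hpre, withDensity_apply _ hs, ← lintegral_indicator hs, ← lintegral_indicator hA,
    ← lintegral_add_right_eq_self _ (R • (y : Space N))]
  refine lintegral_congr fun x => ?_
  have hx : x + R • (y : Space N) ∈ (fun x : Space N => x - R • (y : Space N)) ⁻¹' A ↔ x ∈ A := by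
    simp
  by_cases h : x ∈ A
  · rw [Set.indicator_of_mem (hx.2 h), Set.indicator_of_mem h]
  · rw [Set.indicator_of_notMem (fun h' => h (hx.1 h')), Set.indicator_of_notMem h]

end

/-! Each averaging step convolves with the uniform measure on a circle, so the Green measure at time
`T` is a convolution of circle measures. Since `T > 2τ`, at least two circles of radius `cτ` precede
a last one of radius `R(T) > 0`; at least three circles are involved, and three suffice for a square
integrable density.

Two circles of equal radius `a` give, by an explicit computation in polar coordinates, a density
proportional to `1 / (|x| √(4a² - |x|²))` (`lintegral_sphereUniform_two_add`). It narrowly fails to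
be in `L²`, both at the centre and at the rim, but lies in `L^{3/2}`. For the third circle, of
radius `R`, the square of the `L²` norm of `h * σ_R` is unfolded: it equals the integral of the
autocorrelation of `h` against the density `k` of `σ_R * σ_R`. This is a trilinear form in `h`, `h`,
`k`, bounded by Young's inequality with all exponents `3/2`
(`hasL2Density_sphereMeanMeasure_withDensity`). Further averages preserve `L²` by Jensen, and
supports grow at speed `c`.

For functions, causal diffusion is almost everywhere convolution with the Green measure
(`causalDiffusion_ae_eq_integral`). As `Ω₀` has finite volume, the kernel is square integrable, and
the forward operator is a Hilbert–Schmidt operator, a norm limit of finite rank operators. -/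

noncomputable section

open scoped Pointwise

/-! ### The unit circle and polar coordinates in the plane. -/

/-- The point of the unit circle of `ℝ²` at the angle `θ`. -/
def unitVec (θ : ℝ) : Space 2 := Complex.orthonormalBasisOneI.repr (Complex.exp (θ * Complex.I))

theorem norm_unitVec (θ : ℝ) : ‖unitVec θ‖ = 1 := by
  rw [unitVec, LinearIsometryEquiv.norm_map, Complex.norm_exp_ofReal_mul_I]

@[fun_prop]
theorem continuous_unitVec : Continuous unitVec := by
  unfold unitVec
  exact (LinearIsometryEquiv.continuous _).comp (by fun_prop)

theorem unitVec_periodic : Function.Periodic unitVec (2 * Real.pi) := fun θ => by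
  unfold unitVec
  congr 1
  have := Complex.exp_mul_I_periodic (θ : ℂ)
  push_cast
  exact this

/-- Factoring out the bisecting direction leaves `e^{iα/2} + e^{-iα/2} = 2 cos (α/2)`: the length of
the sum depends only on the relative angle `α`. -/
theorem unitVec_add_unitVec (α β : ℝ) :
    unitVec (α + β) + unitVec β = (2 * Real.cos (α / 2)) • unitVec (β + α / 2) := by
  unfold unitVec
  rw [← map_add, ← map_smul, Complex.real_smul]
  congr 1
  have h1 : Complex.exp (((α + β : ℝ) : ℂ) * Complex.I) =
      Complex.exp (((β + α / 2 : ℝ) : ℂ) * Complex.I) * Complex.exp ((α / 2 : ℂ) * Complex.I) := by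
    rw [← Complex.exp_add]; congr 1; push_cast; ring
  have h2 : Complex.exp ((β : ℂ) * Complex.I) =
      Complex.exp (((β + α / 2 : ℝ) : ℂ) * Complex.I) * Complex.exp (-(α / 2 : ℂ) * Complex.I) := by
    rw [← Complex.exp_add]; congr 1; push_cast; ring
  rw [h1, h2]
  push_cast
  rw [Complex.two_cos]
  ring

/-- The unit circle of `ℝ²`, parametrised by the angle. -/
def circlePoint (θ : ℝ) : sphere (0 : Space 2) 1 :=
  ⟨unitVec θ, by rw [mem_sphere_zero_iff_norm, norm_unitVec]⟩

theorem measurable_circlePoint : Measurable circlePoint :=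
  continuous_unitVec.measurable.subtype_mk

theorem lintegral_space_two_polar {F : Space 2 → ℝ≥0∞} (hF : Measurable F) :
    ∫⁻ x, F x = ∫⁻ r in Set.Ioi (0 : ℝ), ENNReal.ofReal r *
      ∫⁻ θ in Set.Ioc (-Real.pi) Real.pi, F (r • unitVec θ) := by
  rw [← (LinearIsometryEquiv.measurePreserving
    Complex.orthonormalBasisOneI.repr).lintegral_comp hF,
    ← Complex.lintegral_comp_polarCoord_symm]
  have hp : (polarCoord.target : Set (ℝ × ℝ)) =
    Set.Ioi (0 : ℝ) ×ˢ Set.Ioo (-Real.pi) Real.pi := rfl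
  have hpt : ∀ p : ℝ × ℝ, Complex.orthonormalBasisOneI.repr (Complex.polarCoord.symm p) =
      p.1 • unitVec p.2 := fun p => by
    rw [unitVec, ← map_smul, Complex.polarCoord_symm_apply, Complex.real_smul,
      Complex.exp_mul_I]
    push_cast; rfl
  simp only [hpt, smul_eq_mul]
  have hc : Continuous fun p : ℝ × ℝ => p.1 • unitVec p.2 := by fun_prop
  have hm : Measurable fun p : ℝ × ℝ => ENNReal.ofReal p.1 * F (p.1 • unitVec p.2) :=
    (by fun_prop : Measurable fun p : ℝ × ℝ => ENNReal.ofReal p.1).mul (hF.comp hc.measurable)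
  rw [hp, Measure.volume_eq_prod, ← Measure.prod_restrict, lintegral_prod _ hm.aemeasurable]
  refine lintegral_congr fun r => ?_
  have hc' : Continuous fun θ : ℝ => r • unitVec θ := by fun_prop
  have hm' : Measurable fun θ : ℝ => F (r • unitVec θ) := hF.comp hc'.measurable
  simp only
  rw [lintegral_const_mul _ hm', setLIntegral_congr Ioo_ae_eq_Ioc]

/-- `Measure.toSphere` is the dimension times the volume of the sector over the set; in polar
coordinates the radial factor `∫₀¹ r dr = 1/2` cancels the dimension `2`. -/
theorem toSphere_eq_map_circlePoint :
    (volume : Measure (Space 2)).toSphere =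
      (volume.restrict (Set.Ioc (-Real.pi) Real.pi)).map circlePoint := by
  ext s hs
  -- The open sector is the preimage of a measurable rectangle under `homeomorphUnitSphereProd`.
  have hS : MeasurableSet (Set.Ioo (0 : ℝ) 1 • ((↑) '' s : Set (Space 2))) := by
    have h : ((↑) '' (homeomorphUnitSphereProd (Space 2) ⁻¹'
        s ×ˢ Set.Iio (⟨1, Set.mem_Ioi.2 one_pos⟩ : Set.Ioi (0 : ℝ))) : Set (Space 2)) =
        Set.Ioo (0 : ℝ) 1 • ((↑) '' s : Set (Space 2)) := by
      have hI : Set.Ioo (0 : ℝ) 1 = ((↑) '' Set.Iio (⟨1, Set.mem_Ioi.2 one_pos⟩ :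
          Set.Ioi (0 : ℝ)) : Set ℝ) := by rw [Set.image_subtype_val_Ioi_Iio]
      rw [← Set.image2_smul, Set.image2_image_right, ← Homeomorph.image_symm, Set.image_image,
        hI, Set.image2_image_left, Set.image2_swap, ← Set.image_prod]
      rfl
    rw [← h]
    exact (measurableSet_singleton _).compl.subtype_image
      ((homeomorphUnitSphereProd (Space 2)).measurable (hs.prod measurableSet_Iio))
  rw [Measure.toSphere_apply' _ hs, Measure.map_apply measurable_circlePoint hs,
    ← lintegral_indicator_one hS, lintegral_space_two_polar (measurable_one.indicator hS)]
  have key : ∀ r : ℝ, 0 < r → ∀ θ : ℝ,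
      (Set.Ioo (0 : ℝ) 1 • ((↑) '' s : Set (Space 2))).indicator (1 : Space 2 → ℝ≥0∞)
        (r • unitVec θ) =
      (Set.Iio (1 : ℝ)).indicator (1 : ℝ → ℝ≥0∞) r *
        (circlePoint ⁻¹' s).indicator (1 : ℝ → ℝ≥0∞) θ := by
    intro r hr θ
    have : r • unitVec θ ∈ Set.Ioo (0 : ℝ) 1 • ((↑) '' s : Set (Space 2)) ↔
        r ∈ Set.Iio (1 : ℝ) ∧ θ ∈ circlePoint ⁻¹' s := by
      rw [Set.mem_smul]
      constructor
      · rintro ⟨q, hq, _, ⟨y, hy, rfl⟩, h⟩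
        have hn : q = r := by
          have := congrArg norm h
          rwa [norm_smul, norm_smul, norm_unitVec, norm_eq_of_mem_sphere, mul_one, mul_one,
            Real.norm_of_nonneg hq.1.le, Real.norm_of_nonneg hr.le] at this
        subst hn
        refine ⟨hq.2, ?_⟩
        have : (y : Space 2) = unitVec θ := smul_right_injective _ hr.ne' h
        have : circlePoint θ = y := Subtype.ext this.symm
        rwa [Set.mem_preimage, this]
      · rintro ⟨h1, h2⟩
        exact ⟨r, ⟨hr, h1⟩, unitVec θ, ⟨_, h2, rfl⟩, rfl⟩
    by_cases h1 : r ∈ Set.Iio (1 : ℝ) <;> by_cases h2 : θ ∈ circlePoint ⁻¹' s <;>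
      simp [Set.indicator, this, -Set.mem_Iio, -Set.mem_preimage, h1, h2]
  have hm : MeasurableSet (circlePoint ⁻¹' s) := measurable_circlePoint hs
  rw [setLIntegral_congr_fun measurableSet_Ioi (g := fun r => (Set.Iio (1 : ℝ)).indicator
    (fun r => ENNReal.ofReal r) r * volume.restrict (Set.Ioc (-Real.pi) Real.pi)
      (circlePoint ⁻¹' s))]
  · rw [lintegral_mul_const _ (by measurability), lintegral_indicator measurableSet_Iio,
      Measure.restrict_restrict measurableSet_Iio, ← mul_assoc]
    have h2 : ∫⁻ r in Set.Iio (1 : ℝ) ∩ Set.Ioi 0, ENNReal.ofReal r = ENNReal.ofReal (1 / 2) := by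
      rw [Set.inter_comm, Set.Ioi_inter_Iio, setLIntegral_congr Ioo_ae_eq_Ioc,
        ← ofReal_integral_eq_lintegral_ofReal, ← intervalIntegral.integral_of_le zero_le_one,
        integral_id]
      · norm_num
      · exact (intervalIntegral.intervalIntegrable_id (a := 0) (b := 1)).1
      · filter_upwards [ae_restrict_mem measurableSet_Ioc] with x hx using hx.1.le
    rw [h2, finrank_euclideanSpace_fin]
    have : ((2 : ℕ) : ℝ≥0∞) * ENNReal.ofReal (1 / 2) = 1 := by
      rw [← ENNReal.ofReal_natCast, ← ENNReal.ofReal_mul (by norm_num)]; norm_num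
    rw [this, one_mul]
  · intro r hr
    simp only [key r hr]
    rw [lintegral_const_mul _ (measurable_one.indicator hm), lintegral_indicator_one hm]
    by_cases h1 : r < 1 <;> simp [h1]

theorem lintegral_sphereUniform_two {f : sphere (0 : Space 2) 1 → ℝ≥0∞} (hf : Measurable f) :
    ∫⁻ y, f y ∂(sphereUniform 2) = (ENNReal.ofReal (2 * Real.pi))⁻¹ *
      ∫⁻ θ in Set.Ioc (-Real.pi) Real.pi, f (circlePoint θ) := by
  rw [sphereUniform, lintegral_smul_measure, toSphere_eq_map_circlePoint,
    lintegral_map hf measurable_circlePoint, Measure.map_apply measurable_circlePoint .univ]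
  simp [← two_mul]

instance : IsProbabilityMeasure (sphereUniform 2) := by
  refine ⟨?_⟩
  rw [sphereUniform, Measure.smul_apply, smul_eq_mul]
  refine ENNReal.inv_mul_cancel ?_ (measure_ne_top _ _)
  rw [toSphere_eq_map_circlePoint, Measure.map_apply measurable_circlePoint .univ]
  simp [← two_mul, Real.pi_pos]

/-! ### The law of the sum of two random points of a circle. -/

theorem Function.Periodic.setLIntegral_Ioc_comp_add {G : ℝ → ℝ≥0∞} {p : ℝ} (hp : 0 < p)
    (hG : Function.Periodic G p) (t s : ℝ) :
    ∫⁻ θ in Set.Ioc t (t + p), G (θ + s) = ∫⁻ θ in Set.Ioc t (t + p), G θ := by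
  have : Fact (0 < p) := ⟨hp⟩
  have h : ∀ q : ℝ, ∫⁻ θ in Set.Ioc q (q + p), G θ = ∫⁻ b : AddCircle p, hG.lift b :=
    fun q => AddCircle.lintegral_preimage p q hG.lift
  rw [h t, ← h (t + s)]
  have := (measurePreserving_add_right (volume : Measure ℝ) s).setLIntegral_comp_preimage_emb
    (measurableEmbedding_addRight s) G (Set.Ioc (t + s) (t + s + p))
  rw [← this]
  congr 2
  ext θ
  simp only [Set.mem_preimage, Set.mem_Ioc]
  constructor <;> rintro ⟨h1, h2⟩ <;> constructor <;> linarith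

/-- Periodicity is used twice: shifting `α` by `β` makes it the relative angle, and after Tonelli
shifting `β` removes the rotation by `α / 2`. -/
theorem lintegral_lintegral_unitVec_add {F : Space 2 → ℝ≥0∞} (hF : Measurable F) :
    ∫⁻ β in Set.Ioc (-Real.pi) Real.pi, ∫⁻ α in Set.Ioc (-Real.pi) Real.pi,
        F (unitVec α + unitVec β) =
      ∫⁻ α in Set.Ioc (-Real.pi) Real.pi, ∫⁻ β in Set.Ioc (-Real.pi) Real.pi,
        F ((2 * Real.cos (α / 2)) • unitVec β) := by
  have hI : Set.Ioc (-Real.pi) Real.pi = Set.Ioc (-Real.pi) (-Real.pi + 2 * Real.pi) := by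
    congr 1; ring
  have hper : ∀ β, Function.Periodic (fun α => F (unitVec α + unitVec β)) (2 * Real.pi) :=
    fun β α => by simp only [unitVec_periodic α]
  have hper' : ∀ r : ℝ, Function.Periodic (fun β => F (r • unitVec β)) (2 * Real.pi) :=
    fun r α => by simp only [unitVec_periodic α]
  have hc : Continuous fun p : ℝ × ℝ => (2 * Real.cos (p.2 / 2)) • unitVec (p.1 + p.2 / 2) := by
    fun_prop
  calc _ = ∫⁻ β in Set.Ioc (-Real.pi) Real.pi, ∫⁻ α in Set.Ioc (-Real.pi) Real.pi,
        F ((2 * Real.cos (α / 2)) • unitVec (β + α / 2)) := by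
        refine lintegral_congr fun β => ?_
        simp only [← unitVec_add_unitVec]
        rw [hI, (hper β).setLIntegral_Ioc_comp_add Real.two_pi_pos]
    _ = ∫⁻ α in Set.Ioc (-Real.pi) Real.pi, ∫⁻ β in Set.Ioc (-Real.pi) Real.pi,
        F ((2 * Real.cos (α / 2)) • unitVec (β + α / 2)) :=
        lintegral_lintegral_swap (hF.comp hc.measurable).aemeasurable
    _ = _ := by
        refine lintegral_congr fun α => ?_
        rw [hI, (hper' _).setLIntegral_Ioc_comp_add Real.two_pi_pos]

/-- Substitution `r = 2 cos (α/2)`, where `|dr/dα| = sin (α/2) = √(4 - r²) / 2`. The branches `α`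
and `-α` contribute equally, which doubles `2 / √(4 - r²)`. -/
theorem lintegral_two_mul_cos_half (M : ℝ → ℝ≥0∞) :
    ∫⁻ α in Set.Ioc (-Real.pi) Real.pi, M (2 * Real.cos (α / 2)) =
      ∫⁻ r in Set.Ioo (0 : ℝ) 2, ENNReal.ofReal (4 / √(4 - r ^ 2)) * M r := by
  have hpi := Real.pi_pos
  have hneg : ∫⁻ α in Set.Ioo (-Real.pi) 0, M (2 * Real.cos (α / 2)) =
      ∫⁻ α in Set.Ioo 0 Real.pi, M (2 * Real.cos (α / 2)) := by
    rw [← (Measure.measurePreserving_neg (volume : Measure ℝ)).setLIntegral_comp_preimage_emb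
      (MeasurableEquiv.neg ℝ).measurableEmbedding _ (Set.Ioo (-Real.pi) 0)]
    simp [neg_div, Real.cos_neg]
  have hsplit : ∫⁻ α in Set.Ioc (-Real.pi) Real.pi, M (2 * Real.cos (α / 2)) =
      2 * ∫⁻ α in Set.Ioo 0 Real.pi, M (2 * Real.cos (α / 2)) := by
    rw [← Set.Ioc_union_Ioc_eq_Ioc (by linarith : -Real.pi ≤ 0) hpi.le,
      lintegral_union measurableSet_Ioc (Set.Ioc_disjoint_Ioc_of_le le_rfl),
      setLIntegral_congr Ioo_ae_eq_Ioc.symm, setLIntegral_congr Ioo_ae_eq_Ioc.symm, hneg, two_mul]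
  have himg : (fun α : ℝ => 2 * Real.cos (α / 2)) '' Set.Ioo 0 Real.pi = Set.Ioo 0 2 := by
    ext r
    constructor
    · rintro ⟨α, ⟨h1, h2⟩, rfl⟩
      constructor
      · have := Real.cos_pos_of_mem_Ioo (x := α / 2) ⟨by linarith, by linarith⟩
        simpa using this
      · have := Real.cos_lt_cos_of_nonneg_of_le_pi (x := 0) (y := α / 2) le_rfl (by linarith)
          (by linarith)
        rw [Real.cos_zero] at this
        simp only; linarith
    · rintro ⟨h1, h2⟩
      refine ⟨2 * Real.arccos (r / 2), ⟨?_, ?_⟩, ?_⟩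
      · have := Real.arccos_pos.2 (by linarith : r / 2 < 1); linarith
      · have := Real.arccos_lt_pi_div_two.2 (by linarith : 0 < r / 2); linarith
      · simp only
        rw [mul_div_cancel_left₀ _ two_ne_zero, Real.cos_arccos (by linarith) (by linarith)]
        ring
  have hinj : Set.InjOn (fun α : ℝ => 2 * Real.cos (α / 2)) (Set.Ioo 0 Real.pi) := by
    intro x hx y hy h
    have := Real.injOn_cos (x₁ := x / 2) (x₂ := y / 2) ⟨by linarith [hx.1], by linarith [hx.2]⟩
      ⟨by linarith [hy.1], by linarith [hy.2]⟩ (by simpa using h)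
    linarith
  rw [hsplit, ← himg, lintegral_image_eq_lintegral_abs_deriv_mul (f' := fun α => -Real.sin (α / 2))
    measurableSet_Ioo _ hinj, ← lintegral_const_mul' _ _ (by simp)]
  · refine setLIntegral_congr_fun measurableSet_Ioo fun α hα => ?_
    have hs : 0 < Real.sin (α / 2) :=
      Real.sin_pos_of_pos_of_lt_pi (by linarith [hα.1]) (by linarith [hα.2])
    have h4 : √(4 - (2 * Real.cos (α / 2)) ^ 2) = 2 * Real.sin (α / 2) := by
      rw [← Real.sqrt_sq (by positivity : 0 ≤ 2 * Real.sin (α / 2))]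
      congr 1
      nlinarith [Real.sin_sq_add_cos_sq (α / 2)]
    rw [h4, ← mul_assoc, ← ENNReal.ofReal_mul (abs_nonneg _), abs_neg, abs_of_pos hs]
    have : Real.sin (α / 2) * (4 / (2 * Real.sin (α / 2))) = 2 := by field_simp; norm_num
    rw [this, ENNReal.ofReal_ofNat]
  · intro α _
    have := ((Real.hasDerivAt_cos (α / 2)).comp α ((hasDerivAt_id α).div_const 2)).const_mul 2
    refine (this.congr_deriv ?_).hasDerivWithinAt
    ring

theorem unitVec_add_pi (θ : ℝ) : unitVec (θ + Real.pi) = -unitVec θ := by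
  unfold unitVec
  rw [← map_neg]
  congr 1
  push_cast
  rw [add_mul, Complex.exp_add, Complex.exp_pi_mul_I, mul_neg_one]

theorem lintegral_sphereUniform_two_coe {F : Space 2 → ℝ≥0∞} (hF : Measurable F) :
    ∫⁻ y, F (y : Space 2) ∂(sphereUniform 2) = (ENNReal.ofReal (2 * Real.pi))⁻¹ *
      ∫⁻ θ in Set.Ioc (-Real.pi) Real.pi, F (unitVec θ) :=
  lintegral_sphereUniform_two (hF.comp measurable_subtype_coe)

theorem lintegral_sphereUniform_two_neg {F : Space 2 → ℝ≥0∞} (hF : Measurable F) :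
    ∫⁻ y, F (-(y : Space 2)) ∂(sphereUniform 2) = ∫⁻ y, F (y : Space 2) ∂(sphereUniform 2) := by
  rw [lintegral_sphereUniform_two_coe hF,
    lintegral_sphereUniform_two_coe (F := fun y => F (-y)) (hF.comp measurable_neg)]
  have hI : Set.Ioc (-Real.pi) Real.pi = Set.Ioc (-Real.pi) (-Real.pi + 2 * Real.pi) := by
    congr 1; ring
  have hper : Function.Periodic (fun θ => F (unitVec θ)) (2 * Real.pi) :=
    fun α => by simp only [unitVec_periodic α]
  congr 1
  rw [hI, ← hper.setLIntegral_Ioc_comp_add Real.two_pi_pos _ Real.pi]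
  simp only [unitVec_add_pi]

/-- The density of the sum of two independent random points of the unit circle. -/
def chordDensity (x : Space 2) : ℝ≥0∞ :=
  (ball (0 : Space 2) 2).indicator
    (fun x => ENNReal.ofReal ((Real.pi ^ 2 * ‖x‖ * √(4 - ‖x‖ ^ 2))⁻¹)) x

theorem measurable_chordDensity : Measurable chordDensity :=
  Measurable.indicator (by fun_prop) measurableSet_ball

theorem chordDensity_neg (x : Space 2) : chordDensity (-x) = chordDensity x := by
  simp [chordDensity, Set.indicator]

theorem chordDensity_smul_unitVec {r : ℝ} (hr : 0 < r) (θ : ℝ) :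
    chordDensity (r • unitVec θ) = (Set.Iio (2 : ℝ)).indicator
      (fun r => ENNReal.ofReal ((Real.pi ^ 2 * r * √(4 - r ^ 2))⁻¹)) r := by
  have hn : ‖r • unitVec θ‖ = r := by
    rw [norm_smul, norm_unitVec, mul_one, Real.norm_of_nonneg hr.le]
  simp only [chordDensity, Set.indicator, mem_ball_zero_iff, Set.mem_Iio, hn]

theorem lintegral_sphereUniform_two_add {F : Space 2 → ℝ≥0∞} (hF : Measurable F) :
    ∫⁻ y', ∫⁻ y, F ((y : Space 2) + y') ∂(sphereUniform 2) ∂(sphereUniform 2) =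
      ∫⁻ x, F x * chordDensity x := by
  have hpi := Real.pi_pos
  have h1 : ∀ y' : Space 2, ∫⁻ y, F ((y : Space 2) + y') ∂(sphereUniform 2) =
      (ENNReal.ofReal (2 * Real.pi))⁻¹ *
        ∫⁻ α in Set.Ioc (-Real.pi) Real.pi, F (unitVec α + y') := fun y' =>
    lintegral_sphereUniform_two_coe (F := fun y => F (y + y')) (hF.comp (by fun_prop))
  have hm : Measurable fun y' : Space 2 =>
      ∫⁻ α in Set.Ioc (-Real.pi) Real.pi, F (unitVec α + y') := by
    have hc : Continuous fun p : Space 2 × ℝ => unitVec p.2 + p.1 := by fun_prop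
    exact (hF.comp hc.measurable).lintegral_prod_right'
  simp only [h1]
  rw [lintegral_sphereUniform_two_coe (F := fun y' => (ENNReal.ofReal (2 * Real.pi))⁻¹ *
    ∫⁻ α in Set.Ioc (-Real.pi) Real.pi, F (unitVec α + y')) (hm.const_mul _)]
  have hm' : Measurable fun β : ℝ =>
      ∫⁻ α in Set.Ioc (-Real.pi) Real.pi, F (unitVec α + unitVec β) :=
    hm.comp continuous_unitVec.measurable
  rw [lintegral_const_mul _ hm', lintegral_lintegral_unitVec_add hF,
    lintegral_two_mul_cos_half
      (fun r => ∫⁻ β in Set.Ioc (-Real.pi) Real.pi, F (r • unitVec β)),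
    lintegral_space_two_polar (F := fun x => F x * chordDensity x)
      (hF.mul measurable_chordDensity)]
  -- The polar Jacobian `r` cancels the `1/r` of `chordDensity`, and `(2π)⁻² · 4 / √(4 - r²) = 1 /
  -- (π² √(4 - r²))`.
  have h2 : ∀ r ∈ Set.Ioi (0 : ℝ), (ENNReal.ofReal r *
      ∫⁻ θ in Set.Ioc (-Real.pi) Real.pi, F (r • unitVec θ) * chordDensity (r • unitVec θ)) =
      (Set.Iio (2 : ℝ)).indicator (fun r => (ENNReal.ofReal ((2 * Real.pi) ^ 2))⁻¹ *
        (ENNReal.ofReal (4 / √(4 - r ^ 2)) *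
          ∫⁻ β in Set.Ioc (-Real.pi) Real.pi, F (r • unitVec β))) r := by
    intro r hr
    have hr : 0 < r := hr
    have hc : Continuous fun θ : ℝ => r • unitVec θ := by fun_prop
    have hFr : Measurable fun θ : ℝ => F (r • unitVec θ) := hF.comp hc.measurable
    simp only [chordDensity_smul_unitVec hr]
    rw [lintegral_mul_const _ hFr]
    by_cases h : r < 2
    · have hs : 0 < √(4 - r ^ 2) := Real.sqrt_pos.2 (by nlinarith)
      simp only [Set.indicator, Set.mem_Iio, h, if_true]
      rw [mul_comm (∫⁻ _ in _, _), ← mul_assoc, ← mul_assoc,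
        ← ENNReal.ofReal_inv_of_pos (by positivity), ← ENNReal.ofReal_mul hr.le,
        ← ENNReal.ofReal_mul (by positivity)]
      congr 2
      field_simp
      norm_num
    · simp [Set.indicator, h]
  rw [setLIntegral_congr_fun measurableSet_Ioi h2, lintegral_indicator measurableSet_Iio,
    Measure.restrict_restrict measurableSet_Iio, Set.inter_comm, Set.Ioi_inter_Iio,
    lintegral_const_mul' _ _ (by simp [hpi.ne']), ← mul_assoc]
  congr 1
  rw [ENNReal.ofReal_pow (by positivity), sq, ENNReal.mul_inv] <;> simp [hpi]

/-! ### Integrability of the two-circle density to the power `3/2`, and rescaling. -/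

/-- Including the Jacobian, the integrand is of order `r^{-1/2}` at the centre and `(2 - r)^{-3/4}`
at the rim. With exponent `2` both singularities would be of order `-1` and diverge. -/
theorem lintegral_chordDensity_rpow_lt_top :
    ∫⁻ x, chordDensity x ^ (3 / 2 : ℝ) < ∞ := by
  have hpi := Real.pi_pos
  rw [lintegral_space_two_polar (measurable_chordDensity.pow_const _)]
  have hint : ∫⁻ r in Set.Ioo (0 : ℝ) 2,
      ENNReal.ofReal (r ^ (-(1 / 2) : ℝ) + (2 - r) ^ (-(3 / 4) : ℝ)) < ∞ := by
    have h1 : IntervalIntegrable (fun r : ℝ => r ^ (-(1 / 2) : ℝ)) volume 0 2 :=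
      intervalIntegral.intervalIntegrable_rpow' (by norm_num)
    have h2 : IntervalIntegrable (fun r : ℝ => (2 - r) ^ (-(3 / 4) : ℝ)) volume 0 2 := by
      have : IntervalIntegrable (fun r : ℝ => r ^ (-(3 / 4) : ℝ)) volume 0 2 :=
        intervalIntegral.intervalIntegrable_rpow' (by norm_num)
      simpa using (this.comp_sub_left 2).symm
    have h3 := (h1.add h2).1
    rw [setLIntegral_congr Ioo_ae_eq_Ioc]
    refine lt_of_le_of_lt (lintegral_mono fun r => ?_) h3.2
    exact Real.ofReal_le_enorm _
  have hle : ∀ r ∈ Set.Ioi (0 : ℝ), (ENNReal.ofReal r *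
      ∫⁻ θ in Set.Ioc (-Real.pi) Real.pi, chordDensity (r • unitVec θ) ^ (3 / 2 : ℝ)) ≤
      (Set.Iio (2 : ℝ)).indicator (fun r => ENNReal.ofReal (2 * Real.pi) *
        ENNReal.ofReal (r ^ (-(1 / 2) : ℝ) + (2 - r) ^ (-(3 / 4) : ℝ))) r := by
    intro r hr
    have hr : 0 < r := hr
    simp only [chordDensity_smul_unitVec hr]
    by_cases h : r < 2
    · have h2r : 0 < 2 - r := by linarith
      have hs : 0 < 4 - r ^ 2 := by nlinarith
      simp only [Set.indicator, Set.mem_Iio, h, if_true]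
      rw [lintegral_const, Measure.restrict_apply_univ, Real.volume_Ioc,
        ENNReal.ofReal_rpow_of_nonneg (by positivity) (by norm_num),
        ← ENNReal.ofReal_mul (by positivity), ← ENNReal.ofReal_mul hr.le,
        ← ENNReal.ofReal_mul (by positivity)]
      refine ENNReal.ofReal_le_ofReal ?_
      have e1 : (Real.pi ^ 2 * r * √(4 - r ^ 2))⁻¹ ≤ r⁻¹ * (2 - r) ^ (-(1 / 2) : ℝ) := by
        rw [Real.rpow_neg h2r.le, ← Real.sqrt_eq_rpow, ← mul_inv]
        refine inv_anti₀ (by positivity) ?_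
        refine mul_le_mul ?_ (Real.sqrt_le_sqrt (by nlinarith)) (by positivity) (by positivity)
        exact le_mul_of_one_le_left hr.le (by nlinarith [Real.pi_gt_three])
      have e2 : ((Real.pi ^ 2 * r * √(4 - r ^ 2))⁻¹) ^ (3 / 2 : ℝ) ≤
          r ^ (-(3 / 2) : ℝ) * (2 - r) ^ (-(3 / 4) : ℝ) := by
        refine (Real.rpow_le_rpow (by positivity) e1 (by norm_num)).trans_eq ?_
        rw [Real.mul_rpow (by positivity) (by positivity), ← Real.rpow_mul h2r.le,
          ← Real.rpow_neg_one, ← Real.rpow_mul hr.le]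
        norm_num
      have e3 : r * r ^ (-(3 / 2) : ℝ) = r ^ (-(1 / 2) : ℝ) := by
        nth_rewrite 1 [← Real.rpow_one r]
        rw [← Real.rpow_add hr]; norm_num
      -- The two singularities are separated: on each side of `r = 1` one of the factors is at most
      -- `1`.
      have e4 : r ^ (-(1 / 2) : ℝ) * (2 - r) ^ (-(3 / 4) : ℝ) ≤
          r ^ (-(1 / 2) : ℝ) + (2 - r) ^ (-(3 / 4) : ℝ) := by
        have p1 : 0 < r ^ (-(1 / 2) : ℝ) := by positivity
        have p2 : 0 < (2 - r) ^ (-(3 / 4) : ℝ) := by positivity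
        rcases le_total r 1 with h1 | h1
        · have := Real.rpow_le_one_of_one_le_of_nonpos (by linarith : 1 ≤ 2 - r)
            (by norm_num : (-(3 / 4) : ℝ) ≤ 0)
          nlinarith
        · have := Real.rpow_le_one_of_one_le_of_nonpos h1 (by norm_num : (-(1 / 2) : ℝ) ≤ 0)
          nlinarith
      have hl : Real.pi - -Real.pi = 2 * Real.pi := by ring
      rw [hl]
      calc _ ≤ r * (r ^ (-(3 / 2) : ℝ) * (2 - r) ^ (-(3 / 4) : ℝ) * (2 * Real.pi)) := by gcongr
        _ = 2 * Real.pi * (r ^ (-(1 / 2) : ℝ) * (2 - r) ^ (-(3 / 4) : ℝ)) := by rw [← e3]; ring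
        _ ≤ _ := by gcongr
    · simp [Set.indicator, h]
  refine (setLIntegral_mono' measurableSet_Ioi hle).trans_lt ?_
  rw [lintegral_indicator measurableSet_Iio, Measure.restrict_restrict measurableSet_Iio,
    Set.inter_comm, Set.Ioi_inter_Iio, lintegral_const_mul' _ _ ENNReal.ofReal_ne_top]
  exact ENNReal.mul_lt_top ENNReal.ofReal_lt_top hint

theorem lintegral_comp_smul_mul {a : ℝ} (ha : 0 < a) {f : Space 2 → ℝ≥0∞} (hf : Measurable f) :
    ∫⁻ x, f (a • x) = ENNReal.ofReal ((a ^ 2)⁻¹) * ∫⁻ x, f x := by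
  have h := Measure.map_addHaar_smul (volume : Measure (Space 2)) ha.ne'
  rw [finrank_euclideanSpace_fin, abs_of_pos (by positivity)] at h
  rw [← lintegral_map hf (by fun_prop), h, lintegral_smul_measure, smul_eq_mul]

/-- The sum of two independent random points of the circle of radius `a` has a density in
`L^{3/2}`. -/
theorem exists_density_add_circle {a : ℝ} (ha : 0 < a) :
    ∃ h : Space 2 → ℝ≥0∞, Measurable h ∧ (∀ x, h (-x) = h x) ∧ ∫⁻ x, h x ^ (3 / 2 : ℝ) < ∞ ∧
      ∀ F : Space 2 → ℝ≥0∞, Measurable F →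
        ∫⁻ y', ∫⁻ y, F (a • (y : Space 2) + a • (y' : Space 2))
          ∂(sphereUniform 2) ∂(sphereUniform 2) = ∫⁻ x, F x * h x := by
  have hm : Measurable fun x : Space 2 => chordDensity (a⁻¹ • x) :=
    measurable_chordDensity.comp (by fun_prop)
  refine ⟨fun x => ENNReal.ofReal ((a ^ 2)⁻¹) * chordDensity (a⁻¹ • x), hm.const_mul _,
    fun x => by simp only [smul_neg, chordDensity_neg], ?_, fun F hF => ?_⟩
  · simp only [ENNReal.mul_rpow_of_nonneg _ _ (by norm_num : (0 : ℝ) ≤ 3 / 2)]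
    rw [lintegral_const_mul _ (hm.pow_const _),
      lintegral_comp_smul_mul (f := fun x => chordDensity x ^ (3 / 2 : ℝ)) (inv_pos.2 ha)
        (measurable_chordDensity.pow_const _)]
    exact ENNReal.mul_lt_top (ENNReal.rpow_lt_top_of_nonneg (by norm_num) (by simp))
      (ENNReal.mul_lt_top (by simp) lintegral_chordDensity_rpow_lt_top)
  · have h1 := lintegral_sphereUniform_two_add (F := fun x => F (a • x)) (hF.comp (by fun_prop))
    simp only [smul_add] at h1
    rw [h1]
    have h2 := lintegral_comp_smul_mul (f := fun x => F x * chordDensity (a⁻¹ • x)) ha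
      (hF.mul hm)
    simp only [inv_smul_smul₀ ha.ne'] at h2
    rw [h2, ← lintegral_const_mul' _ _ ENNReal.ofReal_ne_top]
    refine lintegral_congr fun x => ?_
    ring

/-! ### Square integrability after the third circle. -/

/-- The smallest of the three numbers is at most the geometric mean of the other two. Integrated,
this is a crude form of Young's trilinear inequality at exponents `3/2`, sufficient for finiteness.
-/
theorem ENNReal.mul_mul_le_rpow_add_rpow_add_rpow (a b c : ℝ≥0∞) :
    a * b * c ≤ (a * b) ^ (3 / 2 : ℝ) + (b * c) ^ (3 / 2 : ℝ) + (a * c) ^ (3 / 2 : ℝ) := by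
  have key : ∀ x y z : ℝ≥0∞, z ≤ x → z ≤ y → x * y * z ≤ (x * y) ^ (3 / 2 : ℝ) := by
    intro x y z hx hy
    have h1 : (x * y) ^ (3 / 2 : ℝ) = x * y * (x * y) ^ (1 / 2 : ℝ) := by
      rw [show (3 / 2 : ℝ) = 1 + 1 / 2 by norm_num,
        ENNReal.rpow_add_of_nonneg _ _ zero_le_one (by norm_num), ENNReal.rpow_one]
    have h2 : z = (z * z) ^ (1 / 2 : ℝ) := by
      rw [← sq, ← ENNReal.rpow_natCast, ← ENNReal.rpow_mul]; norm_num
    rw [h1, h2]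
    gcongr
  rcases le_total a b with hab | hab
  · rcases le_total a c with hac | hac
    · rw [mul_assoc, mul_comm a]
      exact (key b c a hab hac).trans (le_add_right le_add_self)
    · exact (key a b c hac (hac.trans hab)).trans (le_add_right le_self_add)
  · rcases le_total b c with hbc | hbc
    · rw [mul_right_comm]
      exact (key a c b hab hbc).trans le_add_self
    · exact (key a b c (hbc.trans hab) hbc).trans (le_add_right le_self_add)

/-- A measure with a square integrable density. -/
def HasL2Density (μ : Measure (Space 2)) : Prop :=
  ∃ ρ : Space 2 → ℝ≥0∞, Measurable ρ ∧ ∫⁻ x, ρ x ^ 2 < ∞ ∧ μ = volume.withDensity ρ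

/-- Jensen's inequality, here as Hölder against the constant `1` for a probability measure, followed
by Tonelli and translation invariance. -/
theorem HasL2Density.sphereMeanMeasure {μ : Measure (Space 2)} (h : HasL2Density μ) (R : ℝ) :
    HasL2Density (sphereMeanMeasure R μ) := by
  obtain ⟨ρ, hρ, hρ2, rfl⟩ := h
  have hm : Measurable fun p : Space 2 × sphere (0 : Space 2) 1 => ρ (p.1 + R • (p.2 : Space 2)) :=
    hρ.comp (by fun_prop)
  refine ⟨_, hm.lintegral_prod_right', ?_, sphereMeanMeasure_withDensity R hρ⟩
  have hJ : ∀ x : Space 2, (∫⁻ y, ρ (x + R • (y : Space 2)) ∂(sphereUniform 2)) ^ 2 ≤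
      ∫⁻ y, ρ (x + R • (y : Space 2)) ^ 2 ∂(sphereUniform 2) := by
    intro x
    have hx : Measurable fun y : sphere (0 : Space 2) 1 => ρ (x + R • (y : Space 2)) :=
      hρ.comp (by fun_prop)
    have := ENNReal.lintegral_mul_le_Lp_mul_Lq (sphereUniform 2) Real.HolderConjugate.two_two
      hx.aemeasurable (g := 1) aemeasurable_const
    simp only [mul_one, Pi.one_apply, ENNReal.one_rpow, lintegral_one, measure_univ] at this
    calc _ ≤ ((∫⁻ y, ρ (x + R • (y : Space 2)) ^ (2 : ℝ) ∂(sphereUniform 2)) ^ (1 / 2 : ℝ)) ^ 2 := by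
          gcongr
      _ = _ := by
          rw [← ENNReal.rpow_natCast, ← ENNReal.rpow_mul]; norm_num
  refine (lintegral_mono hJ).trans_lt ?_
  rw [lintegral_lintegral_swap (hm.pow_const 2).aemeasurable]
  have : ∀ y : sphere (0 : Space 2) 1, ∫⁻ x, ρ (x + R • (y : Space 2)) ^ 2 = ∫⁻ x, ρ x ^ 2 :=
    fun y => lintegral_add_right_eq_self (fun x => ρ x ^ 2) _
  simpa only [this, lintegral_const, measure_univ, mul_one] using hρ2

theorem lintegral_sphereMeanMeasure {R : ℝ} {μ : Measure (Space 2)} [SFinite μ]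
    {F : Space 2 → ℝ≥0∞} (hF : Measurable F) :
    ∫⁻ x, F x ∂(sphereMeanMeasure R μ) =
      ∫⁻ y, ∫⁻ x, F (x - R • (y : Space 2)) ∂μ ∂(sphereUniform 2) := by
  rw [sphereMeanMeasure, lintegral_map hF (by fun_prop), lintegral_prod_symm]
  exact (hF.comp (by fun_prop)).aemeasurable

/-- The density `h` of the sum of two random points of a circle, smoothed over another circle, is
square integrable: its square integrates to a trilinear expression in functions of `L^{3/2}`. -/
theorem hasL2Density_sphereMeanMeasure_withDensity {R : ℝ} (hR : 0 < R) {h : Space 2 → ℝ≥0∞}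
    (hm : Measurable h) (hh : ∫⁻ x, h x ^ (3 / 2 : ℝ) < ∞) :
    HasL2Density (sphereMeanMeasure R (volume.withDensity h)) := by
  obtain ⟨k, hk, -, hk2, hkF⟩ := exists_density_add_circle hR
  have hm' : Measurable fun p : Space 2 × sphere (0 : Space 2) 1 => h (p.1 + R • (p.2 : Space 2)) :=
    hm.comp (by fun_prop)
  refine ⟨_, hm'.lintegral_prod_right', ?_, sphereMeanMeasure_withDensity R hm⟩
  -- The autocorrelation of `h`: expanding the square and translating `x` leaves `Q` at the
  -- difference of two circle points. The symmetry `y ↦ -y` turns the difference into a sum, whose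
  -- law has density `k`.
  let Q : Space 2 → ℝ≥0∞ := fun z => ∫⁻ x, h x * h (x + z)
  have hQ : Measurable Q := by
    have : Measurable fun p : Space 2 × Space 2 => h p.2 * h (p.2 + p.1) :=
      (hm.comp measurable_snd).mul (hm.comp (by fun_prop))
    exact this.lintegral_prod_right'
  have hm1 : Measurable fun q : (Space 2 × sphere (0 : Space 2) 1) × sphere (0 : Space 2) 1 =>
      h (q.1.1 + R • (q.1.2 : Space 2)) * h (q.1.1 + R • (q.2 : Space 2)) :=
    (hm.comp (by fun_prop)).mul (hm.comp (by fun_prop))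
  calc ∫⁻ x, (∫⁻ y, h (x + R • (y : Space 2)) ∂(sphereUniform 2)) ^ 2
      = ∫⁻ x, ∫⁻ y, ∫⁻ y', h (x + R • (y : Space 2)) * h (x + R • (y' : Space 2))
          ∂(sphereUniform 2) ∂(sphereUniform 2) := by
        refine lintegral_congr fun x => ?_
        have hx : Measurable fun y : sphere (0 : Space 2) 1 => h (x + R • (y : Space 2)) :=
          hm.comp (by fun_prop)
        rw [sq, ← lintegral_mul_const _ hx]
        exact lintegral_congr fun y => (lintegral_const_mul _ hx).symm
    _ = ∫⁻ y, ∫⁻ x, ∫⁻ y', h (x + R • (y : Space 2)) * h (x + R • (y' : Space 2))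
          ∂(sphereUniform 2) ∂volume ∂(sphereUniform 2) :=
        lintegral_lintegral_swap hm1.lintegral_prod_right'.aemeasurable
    _ = ∫⁻ y, ∫⁻ y', ∫⁻ x, h (x + R • (y : Space 2)) * h (x + R • (y' : Space 2))
          ∂volume ∂(sphereUniform 2) ∂(sphereUniform 2) := by
        refine lintegral_congr fun y => lintegral_lintegral_swap ?_
        exact ((hm.comp (by fun_prop)).mul (hm.comp (by fun_prop))).aemeasurable
    _ = ∫⁻ y, ∫⁻ y', Q (R • (y' : Space 2) + R • -(y : Space 2))
          ∂(sphereUniform 2) ∂(sphereUniform 2) := by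
        refine lintegral_congr fun y => lintegral_congr fun y' => ?_
        rw [← lintegral_add_right_eq_self _ (R • -(y : Space 2))]
        refine lintegral_congr fun x => ?_
        rw [smul_neg, neg_add_cancel_right, add_assoc, add_comm (-_)]
    _ = ∫⁻ y, ∫⁻ y', Q (R • (y' : Space 2) + R • (y : Space 2))
          ∂(sphereUniform 2) ∂(sphereUniform 2) := by
        have : Measurable fun y : Space 2 => ∫⁻ y', Q (R • (y' : Space 2) + R • y)
            ∂(sphereUniform 2) := by
          have : Measurable fun p : Space 2 × sphere (0 : Space 2) 1 =>
            Q (R • (p.2 : Space 2) + R • p.1) := hQ.comp (by fun_prop)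
          exact this.lintegral_prod_right'
        exact lintegral_sphereUniform_two_neg this
    _ = ∫⁻ z, Q z * k z := hkF Q hQ
    _ = ∫⁻ z, ∫⁻ x, h x * h (x + z) * k z := by
        refine lintegral_congr fun z => (lintegral_mul_const _ ?_).symm
        exact hm.mul (hm.comp (by fun_prop))
    -- Each term involves only two of the three arguments `x`, `x + z`, `z`, and any two of them are
    -- independent variables, so the double integrals factor.
    _ ≤ ∫⁻ z, ∫⁻ x, ((h x * h (x + z)) ^ (3 / 2 : ℝ) + (h (x + z) * k z) ^ (3 / 2 : ℝ) +
          (h x * k z) ^ (3 / 2 : ℝ)) :=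
        lintegral_mono fun z => lintegral_mono fun x =>
          ENNReal.mul_mul_le_rpow_add_rpow_add_rpow _ _ _
    _ = (∫⁻ x, h x ^ (3 / 2 : ℝ)) * (∫⁻ x, h x ^ (3 / 2 : ℝ)) +
          (∫⁻ x, h x ^ (3 / 2 : ℝ)) * (∫⁻ x, k x ^ (3 / 2 : ℝ)) +
          (∫⁻ x, h x ^ (3 / 2 : ℝ)) * (∫⁻ x, k x ^ (3 / 2 : ℝ)) := by
        have h32 : (0 : ℝ) ≤ 3 / 2 := by norm_num
        have hmp : Measurable fun x => h x ^ (3 / 2 : ℝ) := hm.pow_const _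
        have hkp : Measurable fun x => k x ^ (3 / 2 : ℝ) := hk.pow_const _
        have hmz : ∀ z : Space 2, Measurable fun x => h (x + z) ^ (3 / 2 : ℝ) := fun z =>
          hmp.comp (measurable_add_const z)
        have ht : ∀ z : Space 2, ∫⁻ x, h (x + z) ^ (3 / 2 : ℝ) = ∫⁻ x, h x ^ (3 / 2 : ℝ) :=
          fun z => lintegral_add_right_eq_self (fun x => h x ^ (3 / 2 : ℝ)) z
        have ht' : ∀ x : Space 2, ∫⁻ z, h (x + z) ^ (3 / 2 : ℝ) = ∫⁻ x, h x ^ (3 / 2 : ℝ) :=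
          fun x => lintegral_add_left_eq_self (fun x => h x ^ (3 / 2 : ℝ)) x
        have hA : Measurable fun p : Space 2 × Space 2 =>
            h p.2 ^ (3 / 2 : ℝ) * h (p.2 + p.1) ^ (3 / 2 : ℝ) :=
          (hmp.comp measurable_snd).mul (hmp.comp (by fun_prop : Measurable
            fun p : Space 2 × Space 2 => p.2 + p.1))
        simp only [ENNReal.mul_rpow_of_nonneg _ _ h32]
        have hin : ∀ z : Space 2, ∫⁻ x, (h x ^ (3 / 2 : ℝ) * h (x + z) ^ (3 / 2 : ℝ) +
            h (x + z) ^ (3 / 2 : ℝ) * k z ^ (3 / 2 : ℝ) +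
            h x ^ (3 / 2 : ℝ) * k z ^ (3 / 2 : ℝ)) =
            (∫⁻ x, h x ^ (3 / 2 : ℝ) * h (x + z) ^ (3 / 2 : ℝ)) +
            (∫⁻ x, h x ^ (3 / 2 : ℝ)) * k z ^ (3 / 2 : ℝ) +
            (∫⁻ x, h x ^ (3 / 2 : ℝ)) * k z ^ (3 / 2 : ℝ) := fun z => by
          rw [lintegral_add_right _ (hmp.mul_const _),
            lintegral_add_right _ ((hmz z).mul_const _),
            lintegral_mul_const _ (hmz z), lintegral_mul_const _ hmp, ht]
        simp only [hin]
        rw [lintegral_add_right _ (hkp.const_mul _), lintegral_add_right _ (hkp.const_mul _),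
          lintegral_const_mul _ hkp, lintegral_lintegral_swap hA.aemeasurable,
          ← lintegral_mul_const (∫⁻ x, h x ^ (3 / 2 : ℝ)) hmp]
        congr 2
        refine lintegral_congr fun x => ?_
        rw [← ht' x]
        exact lintegral_const_mul _ (hmp.comp (measurable_const_add _))
    _ < ∞ := by
        refine ENNReal.add_lt_top.2 ⟨ENNReal.add_lt_top.2 ⟨?_, ?_⟩, ?_⟩ <;>
          exact ENNReal.mul_lt_top ‹_› ‹_›

/-! ### Density and support of the Green measure. -/

instance (N : ℕ) (R : ℝ) (μ : Measure (Space N)) [IsFiniteMeasure μ] :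
    IsFiniteMeasure (sphereMeanMeasure R μ) := by
  unfold sphereMeanMeasure; infer_instance

instance isFiniteMeasure_diffusionStepMeasure (N : ℕ) (c τ : ℝ) (μ : Measure (Space N))
    [IsFiniteMeasure μ] (n : ℕ) : IsFiniteMeasure (diffusionStepMeasure c τ μ n) := by
  induction n with
  | zero => simpa only [diffusionStepMeasure]
  | succ n ih => simp only [diffusionStepMeasure]; infer_instance

theorem exists_diffusionStepMeasure_two_eq {c τ : ℝ} (hc : 0 < c * τ) :
    ∃ h : Space 2 → ℝ≥0∞, Measurable h ∧ ∫⁻ x, h x ^ (3 / 2 : ℝ) < ∞ ∧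
      diffusionStepMeasure c τ (Measure.dirac (0 : Space 2)) 2 = volume.withDensity h := by
  obtain ⟨h, hm, hneg, hh, hF⟩ := exists_density_add_circle hc
  refine ⟨h, hm, hh, Measure.ext_of_lintegral _ fun F hFm => ?_⟩
  have hF1 : ∀ y' : Space 2, Measurable fun x : Space 2 => F (x - (c * τ) • y') := fun y' =>
    hFm.comp (by fun_prop)
  simp only [diffusionStepMeasure]
  rw [lintegral_sphereMeanMeasure hFm]
  simp only [lintegral_sphereMeanMeasure (hF1 _)]
  have h0 : ∀ y y' : Space 2, ∫⁻ x, F (x - (c * τ) • y - (c * τ) • y') ∂(Measure.dirac 0) =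
      F (-((c * τ) • y + (c * τ) • y')) := fun y y' => by
    have h1 : Measurable fun x : Space 2 => F (x - (c * τ) • y - (c * τ) • y') :=
      hFm.comp (by fun_prop)
    rw [lintegral_dirac' _ h1]
    congr 1; abel
  simp only [h0]
  -- `sphereMeanMeasure` moves mass by `-R • y`, hence the reflected test function; the evenness of
  -- `h` undoes the reflection.
  rw [hF (fun x => F (-x)) (hFm.comp measurable_neg),
    lintegral_withDensity_eq_lintegral_mul _ hm hFm,
    ← (Measure.measurePreserving_neg volume).lintegral_comp (hm.mul hFm)]
  refine lintegral_congr fun x => ?_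
  rw [Pi.mul_apply, hneg, mul_comm]

theorem hasL2Density_diffusionStepMeasure {c τ : ℝ} (hc : 0 < c * τ) (n : ℕ) :
    HasL2Density (diffusionStepMeasure c τ (Measure.dirac (0 : Space 2)) (n + 3)) := by
  induction n with
  | zero =>
    obtain ⟨h, hm, hh, he⟩ := exists_diffusionStepMeasure_two_eq hc
    rw [zero_add, diffusionStepMeasure, he]
    exact hasL2Density_sphereMeanMeasure_withDensity hc hm hh
  | succ n ih =>
    rw [show n + 1 + 3 = (n + 3) + 1 by ring, diffusionStepMeasure]
    exact ih.sphereMeanMeasure _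

theorem hasL2Density_greenMeasure {c τ T : ℝ} (hc : 0 < c) (hτ : 0 < τ) (hT : 2 * τ < T) :
    HasL2Density (greenMeasure 2 c τ T) := by
  have hT0 : 0 < T := by linarith
  have hn : 2 ≤ stepIndex τ T := by
    have h2 : (2 : ℝ) < T / τ := by rwa [lt_div_iff₀ hτ]
    have : 2 < ⌈T / τ⌉₊ := Nat.lt_ceil.2 (by exact_mod_cast h2)
    unfold stepIndex; omega
  have hcτ : 0 < c * τ := mul_pos hc hτ
  rw [greenMeasure, causalDiffusionMeasure, if_neg (not_le.2 hT0)]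
  obtain ⟨m, hm⟩ := Nat.exists_eq_add_of_le hn
  -- With exactly two full steps the third circle has radius `stepRadius c τ T`, positive because
  -- the interval for `T` is open on the left. Otherwise the third circle has radius `c * τ` and the
  -- last average merely preserves `L²`.
  rcases m with _ | m
  · obtain ⟨h, hmeas, hh, he⟩ := exists_diffusionStepMeasure_two_eq hcτ
    rw [hm, add_zero, he]
    refine hasL2Density_sphereMeanMeasure_withDensity ?_ hmeas hh
    exact mul_pos hc (sub_pos.2 (stepIndex_spec hτ hT0).1)
  · rw [hm, show 2 + (m + 1) = m + 3 by ring]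
    exact (hasL2Density_diffusionStepMeasure hcτ m).sphereMeanMeasure _

theorem sphereMeanMeasure_compl_closedBall {N : ℕ} {R r : ℝ} {μ : Measure (Space N)} [SFinite μ]
    (hR : 0 ≤ R) (h : μ (closedBall 0 r)ᶜ = 0) :
    sphereMeanMeasure R μ (closedBall 0 (r + R))ᶜ = 0 := by
  rw [sphereMeanMeasure, Measure.map_apply (by fun_prop) measurableSet_closedBall.compl]
  refine measure_mono_null (t := (closedBall 0 r)ᶜ ×ˢ Set.univ) ?_ ?_
  · rintro ⟨x, y⟩ hx
    simp only [Set.mem_preimage, Set.mem_compl_iff, mem_closedBall_zero_iff, not_le,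
      Set.mem_prod, Set.mem_univ, and_true] at hx ⊢
    have := norm_sub_le x (R • (y : Space N))
    rw [norm_smul, norm_eq_of_mem_sphere, mul_one, Real.norm_of_nonneg hR] at this
    linarith
  · rw [Measure.prod_prod, h, zero_mul]

theorem diffusionStepMeasure_compl_closedBall {N : ℕ} {c τ : ℝ} (hc : 0 ≤ c * τ) (n : ℕ) :
    diffusionStepMeasure c τ (Measure.dirac (0 : Space N)) n (closedBall 0 (n * (c * τ)))ᶜ = 0 := by
  induction n with
  | zero => simp [diffusionStepMeasure]
  | succ n ih =>
    have := sphereMeanMeasure_compl_closedBall hc ih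
    rw [diffusionStepMeasure]
    convert this using 4
    push_cast; ring

theorem greenMeasure_compl_closedBall {N : ℕ} {c τ T : ℝ} (hc : 0 < c) (hτ : 0 < τ) (hT : 0 < T) :
    greenMeasure N c τ T (closedBall 0 (c * T))ᶜ = 0 := by
  rw [greenMeasure, causalDiffusionMeasure, if_neg (not_le.2 hT)]
  have hR : 0 ≤ stepRadius c τ T := (mul_pos hc (sub_pos.2 (stepIndex_spec hτ hT).1)).le
  have := sphereMeanMeasure_compl_closedBall hR
    (diffusionStepMeasure_compl_closedBall (N := N) (mul_pos hc hτ).le (stepIndex τ T))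
  convert this using 4
  rw [stepRadius]; ring

/-! ### Causal diffusion of functions as convolution with the Green measure. -/

section representation

variable {N : ℕ} {𝕜 : Type*} [RCLike 𝕜]

/-- Spheres are null sets for positive `N`, so this is false for individual centres. By Fubini,
translates of a null set being null, almost every centre sees the exceptional set in a null set of
directions. -/
theorem sphereMean_congr_ae (R : ℝ) {f g : Space N → 𝕜} (h : f =ᵐ[volume] g) :
    sphereMean R f =ᵐ[volume] sphereMean R g := by
  obtain ⟨s, hs, hsm, hs0⟩ := exists_measurable_superset_of_null (ae_iff.1 h)
  have hm : MeasurableSet {p : Space N × sphere (0 : Space N) 1 | p.1 + R • (p.2 : Space N) ∈ s} :=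
    hsm.preimage (by fun_prop)
  have h0 : (volume.prod (sphereUniform N))
      {p : Space N × sphere (0 : Space N) 1 | p.1 + R • (p.2 : Space N) ∈ s} = 0 := by
    rw [Measure.prod_apply_symm hm, lintegral_eq_zero_of_ae_eq_zero (.of_forall fun y => ?_)]
    exact (measure_preimage_add_right volume (R • (y : Space N)) s).trans hs0
  have := Measure.ae_ae_of_ae_prod (measure_eq_zero_iff_ae_notMem.1 h0)
  filter_upwards [this] with x hx
  refine integral_congr_ae ?_
  filter_upwards [hx] with y hy
  by_contra hne
  exact hy (hs hne)

/-- Supplies the integrability that Fubini needs for Bochner integrals in `sphereMean_integral_sub`.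
-/
theorem ae_integrable_comp_sub {w : Space N → 𝕜} (hw : StronglyMeasurable w)
    (hi : Integrable w) (μ : Measure (Space N)) [IsFiniteMeasure μ] :
    ∀ᵐ x, Integrable (fun z => w (x - z)) μ := by
  have hm : StronglyMeasurable fun p : Space N × Space N => w (p.1 - p.2) :=
    hw.comp_measurable (by fun_prop)
  have : Integrable (fun p : Space N × Space N => w (p.1 - p.2)) (volume.prod μ) := by
    rw [integrable_prod_iff' hm.aestronglyMeasurable]
    refine ⟨.of_forall fun z => hi.comp_sub_right z, ?_⟩
    have : ∀ z : Space N, ∫ x, ‖w (x - z)‖ = ∫ x, ‖w x‖ := fun z =>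
      integral_sub_right_eq_self (fun x => ‖w x‖) z
    simp only [this]
    exact integrable_const _
  exact this.prod_right_ae

theorem sphereMean_integral_sub {w : Space N → 𝕜} (hw : StronglyMeasurable w)
    (hi : Integrable w) (R : ℝ) (μ : Measure (Space N)) [IsFiniteMeasure μ] :
    sphereMean R (fun x => ∫ z, w (x - z) ∂μ) =ᵐ[volume]
      fun x => ∫ z, w (x - z) ∂(sphereMeanMeasure R μ) := by
  have hT : Measurable fun p : Space N × sphere (0 : Space N) 1 => p.1 - R • (p.2 : Space N) := by
    fun_prop
  filter_upwards [ae_integrable_comp_sub hw hi (sphereMeanMeasure R μ)] with x hx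
  have hwx : StronglyMeasurable fun z => w (x - z) := hw.comp_measurable (by fun_prop)
  have hx' := (integrable_map_measure hwx.aestronglyMeasurable hT.aemeasurable).1 hx
  simp only [Function.comp_def] at hx'
  rw [sphereMeanMeasure, integral_map hT.aemeasurable hwx.aestronglyMeasurable,
    integral_prod_symm _ hx', sphereMean]
  refine integral_congr_ae (.of_forall fun y => integral_congr_ae (.of_forall fun z => ?_))
  simp only
  congr 1
  abel

/-- The measures on the right may be singular, so an integral against them is not determined by the
class of `u`; it is formed with a fixed strongly measurable representative `w`. -/
theorem diffusionStep_ae_eq_integral {w : Space N → 𝕜} (hw : StronglyMeasurable w)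
    (hi : Integrable w) {u : Space N → 𝕜} (huw : u =ᵐ[volume] w) (c τ : ℝ) (n : ℕ) :
    diffusionStep c τ u n =ᵐ[volume]
      fun x => ∫ z, w (x - z) ∂(diffusionStepMeasure c τ (Measure.dirac 0) n) := by
  induction n with
  | zero =>
    filter_upwards [huw] with x hx
    have hwx : StronglyMeasurable fun z => w (x - z) := hw.comp_measurable (by fun_prop)
    rw [diffusionStep, diffusionStepMeasure, integral_dirac' _ _ hwx, sub_zero, hx]
  | succ n ih =>
    exact (sphereMean_congr_ae _ ih).trans (sphereMean_integral_sub hw hi _ _)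

theorem causalDiffusion_ae_eq_integral {w : Space N → 𝕜} (hw : StronglyMeasurable w)
    (hi : Integrable w) {u : Space N → 𝕜} (huw : u =ᵐ[volume] w) (c τ : ℝ) {t : ℝ} (ht : 0 < t) :
    causalDiffusion c τ u t =ᵐ[volume] fun x => ∫ z, w (x - z) ∂(greenMeasure N c τ t) := by
  simp only [causalDiffusion, greenMeasure, causalDiffusionMeasure, if_neg (not_le.2 ht)]
  exact (sphereMean_congr_ae _ (diffusionStep_ae_eq_integral hw hi huw c τ _)).trans
    (sphereMean_integral_sub hw hi _ _)

/-- Once the Green measure is absolutely continuous, the representative can be exchanged for `u`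
itself. -/
theorem causalDiffusion_ae_eq_integral_density {c τ t : ℝ} (ht : 0 < t) {g : Space N → ℝ}
    (hg : Measurable g) (hg0 : ∀ x, 0 ≤ g x)
    (hG : greenMeasure N c τ t = volume.withDensity fun x => ENNReal.ofReal (g x))
    {u : Space N → 𝕜} (hu : Integrable u) :
    causalDiffusion c τ u t =ᵐ[volume] fun x => ∫ x', ((g (x - x') : ℝ) : 𝕜) * u x' := by
  have hw := hu.1.stronglyMeasurable_mk
  have huw := hu.1.ae_eq_mk
  filter_upwards [causalDiffusion_ae_eq_integral hw (hu.congr huw) huw c τ ht] with x hx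
  rw [hx, hG, integral_withDensity_eq_integral_toReal_smul hg.ennreal_ofReal
    (.of_forall fun _ => ENNReal.ofReal_lt_top), ← integral_sub_left_eq_self _ volume x]
  refine integral_congr_ae ?_
  filter_upwards [huw] with x' hx'
  rw [ENNReal.toReal_ofReal (hg0 _), sub_sub_cancel, ← hx', RCLike.real_smul_eq_coe_mul]

end representation

/-! ### The Green function and its convolution kernel. -/

/-- The Green function at a time `T > 2τ` is a square integrable function. -/
theorem exists_greenFunction {c τ T : ℝ} (hc : 0 < c) (hτ : 0 < τ) (hT : 2 * τ < T) :
    ∃ g : Space 2 → ℝ, Measurable g ∧ (∀ x, 0 ≤ g x) ∧ MemLp g 2 volume ∧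
      (∀ x, c * T < ‖x‖ → g x = 0) ∧
      greenMeasure 2 c τ T = volume.withDensity fun x => ENNReal.ofReal (g x) := by
  obtain ⟨ρ, hρ, hρ2, hG⟩ := hasL2Density_greenMeasure hc hτ hT
  have hsupp := greenMeasure_compl_closedBall (N := 2) hc hτ (by linarith : 0 < T)
  rw [hG, withDensity_apply _ measurableSet_closedBall.compl, lintegral_eq_zero_iff hρ,
    Filter.EventuallyEq, ae_restrict_iff' measurableSet_closedBall.compl] at hsupp
  have hfin : ∀ᵐ x, ρ x < ∞ := by
    filter_upwards [ae_lt_top (hρ.pow_const 2) hρ2.ne] with x hx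
    exact (ENNReal.pow_lt_top_iff.1 hx).resolve_right two_ne_zero
  -- The cut-off makes `g` vanish everywhere outside the ball, not just almost everywhere, as
  -- compact support requires.
  let g : Space 2 → ℝ := (closedBall 0 (c * T)).indicator fun x => (ρ x).toReal
  have hg : Measurable g := hρ.ennreal_toReal.indicator measurableSet_closedBall
  have hg0 : ∀ x, 0 ≤ g x := fun x => Set.indicator_nonneg (fun _ _ => ENNReal.toReal_nonneg) x
  have hgρ : ∀ᵐ x, ENNReal.ofReal (g x) = ρ x := by
    filter_upwards [hsupp, hfin] with x h1 h2
    by_cases hx : x ∈ closedBall (0 : Space 2) (c * T)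
    · simp only [g, Set.indicator_of_mem hx, ENNReal.ofReal_toReal h2.ne]
    · simp only [g, Set.indicator_of_notMem hx, ENNReal.ofReal_zero]
      exact (h1 hx).symm
  refine ⟨g, hg, hg0, ?_, fun x hx => ?_, ?_⟩
  · refine ⟨hg.aestronglyMeasurable, ?_⟩
    rw [eLpNorm_lt_top_iff_lintegral_rpow_enorm_lt_top two_ne_zero ENNReal.ofNat_ne_top]
    convert hρ2 using 1
    refine lintegral_congr_ae ?_
    filter_upwards [hgρ] with x hx
    rw [Real.enorm_eq_ofReal (hg0 x), hx]
    norm_num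
  · exact Set.indicator_of_notMem (by simpa using hx) _
  · rw [hG]
    exact withDensity_congr_ae (hgρ.mono fun _ h => h.symm)

/-- Even with the first variable in the whole plane, the squared norm is `‖g‖²` times the volume of
`Ω`. -/
theorem memLp_two_comp_sub {g : Space 2 → ℝ} (hg : Measurable g) (hg2 : MemLp g 2 volume)
    (B Ω : Set (Space 2)) (hΩ : volume Ω < ∞) :
    MemLp (fun p : Space 2 × Space 2 => g (p.1 - p.2)) 2
      ((volume.restrict B).prod (volume.restrict Ω)) := by
  have : IsFiniteMeasure ((volume : Measure (Space 2)).restrict Ω) := ⟨by simpa⟩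
  have hm : Measurable fun p : Space 2 × Space 2 => g (p.1 - p.2) := hg.comp (by fun_prop)
  have hsq := (memLp_two_iff_integrable_sq_norm hg2.1).1 hg2
  have h : MemLp (fun p : Space 2 × Space 2 => g (p.1 - p.2)) 2
      ((volume : Measure (Space 2)).prod (volume.restrict Ω)) := by
    rw [memLp_two_iff_integrable_sq_norm hm.aestronglyMeasurable,
      integrable_prod_iff' (hm.norm.pow_const 2).aestronglyMeasurable]
    refine ⟨.of_forall fun z => hsq.comp_sub_right z, ?_⟩
    have : ∀ z : Space 2, ∫ x, ‖‖g (x - z)‖ ^ 2‖ = ∫ x, ‖‖g x‖ ^ 2‖ := fun z =>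
      integral_sub_right_eq_self (fun x => ‖‖g x‖ ^ 2‖) z
    simp only [this]
    exact integrable_const _
  refine h.mono_measure ?_
  have hv : (volume : Measure (Space 2)).prod (volume.restrict Ω) =
      (volume.restrict Set.univ).prod (volume.restrict Ω) := by rw [Measure.restrict_univ]
  rw [hv, Measure.prod_restrict, Measure.prod_restrict]
  exact Measure.restrict_mono (Set.prod_mono_left (Set.subset_univ _)) le_rfl

/-! ### Hilbert–Schmidt operators and square integrable kernels. -/

/-- A Hilbert–Schmidt operator is compact. -/
theorem isCompactOperator_of_sum_norm_sq_le {ι 𝕜 E G : Type*} [RCLike 𝕜]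
    [NormedAddCommGroup E] [InnerProductSpace 𝕜 E]
    [NormedAddCommGroup G] [InnerProductSpace 𝕜 G] [CompleteSpace G]
    (b : HilbertBasis ι 𝕜 E) (F : E →L[𝕜] G) (C : ℝ)
    (hF : ∀ s : Finset ι, ∑ i ∈ s, ‖F (b i)‖ ^ 2 ≤ C) : IsCompactOperator F := by
  classical
  -- Finite rank truncations of `F`. They converge to `F` pointwise; the tail of `∑ ‖F (b i)‖²`,
  -- with Cauchy–Schwarz and Bessel, upgrades this to convergence in norm.
  let P : Finset ι → E →L[𝕜] G := fun s => ∑ i ∈ s, (innerSL 𝕜 (b i)).smulRight (F (b i))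
  have hP : ∀ s u, P s u = ∑ i ∈ s, inner 𝕜 (b i) u • F (b i) := fun s u => by
    simp [P]
  have hcpt : ∀ s, IsCompactOperator (P s) := by
    intro s
    induction s using Finset.cons_induction with
    | empty =>
      have : P ∅ = 0 := by simp [P]
      rw [this]; exact isCompactOperator_zero
    | cons i s hi ih =>
      have : P (Finset.cons i s hi) = (innerSL 𝕜 (b i)).smulRight (F (b i)) + P s := by
        simp only [P, Finset.sum_cons]
      rw [this]
      refine IsCompactOperator.add ?_ ih
      exact (isCompactOperator_of_locallyCompactSpace_rng
        (ContinuousLinearMap.toSpanSingleton 𝕜 (F (b i)))).comp_clm (innerSL 𝕜 (b i))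
  have hlim : ∀ u, Filter.Tendsto (fun s => P s u) Filter.atTop (nhds (F u)) := fun u => by
    have := (b.hasSum_repr u).mapL F
    simpa only [map_smul, hP, HilbertBasis.repr_apply_apply, HasSum,
      SummationFilter.unconditional_filter] using this
  have hsum : Summable fun i => ‖F (b i)‖ ^ 2 :=
    summable_of_sum_le (fun _ => by positivity) hF
  refine isCompactOperator_of_tendsto (l := Filter.atTop) (F := P) ?_ (.of_forall hcpt)
  rw [Metric.tendsto_atTop]
  intro ε hε
  obtain ⟨s₀, hs₀⟩ := summable_iff_vanishing_norm.1 hsum ((ε / 2) ^ 2) (by positivity)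
  refine ⟨s₀, fun s hs => ?_⟩
  rw [dist_eq_norm]
  refine lt_of_le_of_lt (ContinuousLinearMap.opNorm_le_bound _ (half_pos hε).le fun u => ?_)
    (half_lt_self hε)
  rw [sub_apply]
  have hl : Filter.Tendsto (fun t => ‖P s u - P t u‖) Filter.atTop (nhds ‖P s u - F u‖) :=
    (tendsto_const_nhds.sub (hlim u)).norm
  refine le_of_tendsto hl ?_
  filter_upwards [Filter.eventually_ge_atTop s] with t ht
  have hd : P s u - P t u = -∑ i ∈ t \ s, inner 𝕜 (b i) u • F (b i) := by
    rw [hP, hP, ← Finset.sum_sdiff ht]; abel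
  rw [hd, norm_neg]
  have hA : ∑ i ∈ t \ s, ‖F (b i)‖ ^ 2 ≤ (ε / 2) ^ 2 := by
    have := hs₀ (t \ s) (Finset.disjoint_of_subset_right hs Finset.sdiff_disjoint)
    exact (le_abs_self _).trans this.le
  have hB : ∑ i ∈ t \ s, ‖inner 𝕜 (b i) u‖ ^ 2 ≤ ‖u‖ ^ 2 := b.orthonormal.sum_inner_products_le u
  refine (norm_sum_le _ _).trans (abs_le_of_sq_le_sq' ?_ (by positivity)).2
  simp only [norm_smul]
  calc _ ≤ (∑ i ∈ t \ s, ‖inner 𝕜 (b i) u‖ ^ 2) * ∑ i ∈ t \ s, ‖F (b i)‖ ^ 2 :=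
        Finset.sum_mul_sq_le_sq_mul_sq _ _ _
    _ ≤ ‖u‖ ^ 2 * (ε / 2) ^ 2 := by gcongr
    _ = _ := by ring

theorem L2_norm_sq_eq_integral {α 𝕜 : Type*} [RCLike 𝕜] {m : MeasurableSpace α} {μ : Measure α}
    (f : Lp 𝕜 2 μ) : ‖f‖ ^ 2 = ∫ x, ‖f x‖ ^ 2 ∂μ := by
  have h := L2.inner_def (𝕜 := 𝕜) f f
  simp only [inner_self_eq_norm_sq_to_K] at h
  have h2 : ∫ x, ((‖f x‖ : ℝ) : 𝕜) ^ 2 ∂μ = ((∫ x, ‖f x‖ ^ 2 ∂μ : ℝ) : 𝕜) := by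
    rw [← integral_ofReal]; push_cast; rfl
  rw [h2] at h
  exact_mod_cast h

section kernel

variable {α β 𝕜 : Type*} [RCLike 𝕜] [MeasurableSpace α] [MeasurableSpace β]
  {μ : Measure α} {ν : Measure β} [SFinite μ] [SFinite ν] {K : α × β → 𝕜}

/-- The vector is the conjugate of the slice `K (x, ·)`, since the inner product is conjugate linear
in its first argument. It depends on `x` only, so one null set serves all `u`. -/
theorem ae_exists_integral_mul_eq_inner (hK : MemLp K 2 (μ.prod ν)) :
    ∀ᵐ x ∂μ, ∃ k : Lp 𝕜 2 ν, ‖k‖ ^ 2 = ∫ y, ‖K (x, y)‖ ^ 2 ∂ν ∧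
      ∀ u : Lp 𝕜 2 ν, ∫ y, K (x, y) * u y ∂ν = inner 𝕜 k u := by
  have h1 := ((memLp_two_iff_integrable_sq_norm hK.1).1 hK).prod_right_ae
  have h2 := hK.1.prodMk_left
  filter_upwards [h1, h2] with x h1 h2
  have hk : MemLp (fun y => K (x, y)) 2 ν := (memLp_two_iff_integrable_sq_norm h2).2 h1
  have hs : MemLp (fun y => star (K (x, y))) 2 ν := hk.star
  refine ⟨hs.toLp, ?_, fun u => ?_⟩
  · rw [L2_norm_sq_eq_integral]
    refine integral_congr_ae ?_
    filter_upwards [hs.coeFn_toLp] with y hy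
    rw [hy, norm_star]
  · rw [L2.inner_def]
    refine integral_congr_ae ?_
    filter_upwards [hs.coeFn_toLp] with y hy
    rw [hy, RCLike.inner_apply, RCLike.star_def, RCLike.conj_conj, mul_comm]

theorem memLp_two_integral_kernel_mul (hK : MemLp K 2 (μ.prod ν)) (u : Lp 𝕜 2 ν) :
    MemLp (fun x => ∫ y, K (x, y) * u y ∂ν) 2 μ := by
  have hm : AEStronglyMeasurable (fun x => ∫ y, K (x, y) * u y ∂ν) μ :=
    (hK.1.mul (Lp.aestronglyMeasurable u).comp_snd).integral_prod_right'
  rw [memLp_two_iff_integrable_sq_norm hm]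
  have hN : Integrable (fun x => (∫ y, ‖K (x, y)‖ ^ 2 ∂ν) * ‖u‖ ^ 2) μ :=
    ((memLp_two_iff_integrable_sq_norm hK.1).1 hK).integral_prod_left.mul_const _
  refine hN.mono' (hm.norm.pow 2) ?_
  filter_upwards [ae_exists_integral_mul_eq_inner hK] with x ⟨k, hk, hu⟩
  rw [hu, ← hk, ← mul_pow, norm_pow, norm_norm]
  gcongr
  exact norm_inner_le_norm _ _

/-- A square integrable kernel defines a compact integral operator between `L²` spaces. -/
theorem exists_isCompactOperator_of_memLp_kernel (hK : MemLp K 2 (μ.prod ν)) :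
    ∃ F : Lp 𝕜 2 ν →L[𝕜] Lp 𝕜 2 μ,
      (∀ u, F u =ᵐ[μ] fun x => ∫ y, K (x, y) * u y ∂ν) ∧ IsCompactOperator F := by
  have hae := ae_exists_integral_mul_eq_inner hK
  have hKint := (memLp_two_iff_integrable_sq_norm hK.1).1 hK
  let L : Lp 𝕜 2 ν →ₗ[𝕜] Lp 𝕜 2 μ :=
    { toFun := fun u => (memLp_two_integral_kernel_mul hK u).toLp
      map_add' := fun u v => by
        rw [← MemLp.toLp_add]
        refine MemLp.toLp_congr _ _ ?_
        filter_upwards [hae] with x ⟨k, _, hu⟩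
        simp only [Pi.add_apply, hu, inner_add_right]
      map_smul' := fun a u => by
        rw [RingHom.id_apply, ← MemLp.toLp_const_smul]
        refine MemLp.toLp_congr _ _ ?_
        filter_upwards [hae] with x ⟨k, _, hu⟩
        simp only [Pi.smul_apply, hu, inner_smul_right, smul_eq_mul] }
  have hL : ∀ u, L u =ᵐ[μ] fun x => ∫ y, K (x, y) * u y ∂ν := fun u =>
    (memLp_two_integral_kernel_mul hK u).coeFn_toLp
  have hLsq : ∀ u, Integrable (fun x => ‖L u x‖ ^ 2) μ := fun u =>
    (memLp_two_iff_integrable_sq_norm (Lp.aestronglyMeasurable _)).1 (Lp.memLp (L u))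
  -- The square of the Hilbert–Schmidt norm; it bounds both the operator norm squared and the sums
  -- over a Hilbert basis.
  set C : ℝ := ∫ x, ∫ y, ‖K (x, y)‖ ^ 2 ∂ν ∂μ with hC
  have hC0 : 0 ≤ C := by positivity
  have hbound : ∀ u, ‖L u‖ ≤ √C * ‖u‖ := by
    intro u
    refine (abs_le_of_sq_le_sq' ?_ (by positivity)).2
    rw [mul_pow, Real.sq_sqrt hC0, L2_norm_sq_eq_integral, hC, ← integral_mul_const]
    refine integral_mono_ae (hLsq u) (hKint.integral_prod_left.mul_const _) ?_
    filter_upwards [hae, hL u] with x ⟨k, hk, hu⟩ hx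
    rw [hx, hu, ← hk, ← mul_pow]
    gcongr
    exact norm_inner_le_norm _ _
  refine ⟨L.mkContinuous _ hbound, hL, ?_⟩
  obtain ⟨w, b, -⟩ := exists_hilbertBasis 𝕜 (Lp 𝕜 2 ν)
  refine isCompactOperator_of_sum_norm_sq_le b _ C fun s => ?_
  simp only [LinearMap.mkContinuous_apply, L2_norm_sq_eq_integral]
  rw [← integral_finsetSum _ fun i _ => hLsq (b i)]
  refine integral_mono_ae (integrable_finsetSum _ fun i _ => hLsq (b i))
    hKint.integral_prod_left ?_
  have hall : ∀ᵐ x ∂μ, ∀ i ∈ s, L (b i) x = ∫ y, K (x, y) * b i y ∂ν :=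
    (Finset.eventually_all s).2 fun i _ => hL (b i)
  filter_upwards [hae, hall] with x ⟨k, hk, hu⟩ hx
  rw [← hk]
  -- Bessel's inequality for the slice at fixed `x`.
  refine le_trans (le_of_eq ?_) (b.orthonormal.sum_inner_products_le (s := s) k)
  refine Finset.sum_congr rfl fun i hi => ?_
  rw [hx i hi, hu, norm_inner_symm]

end kernel

end

/-! ### The forward operator. -/

theorem mainTheorem2 {𝕜 : Type*} [RCLike 𝕜] (c τ T : ℝ) (hc : 0 < c) (hτ : 0 < τ)
    (hT : 2 * τ < T) :
    ∃ g : Space 2 → ℝ,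
      -- the Green function at time `T` is a function in `L²` with compact support
      ((∀ x, 0 ≤ g x) ∧ MemL2c g ∧
        greenMeasure 2 c τ T = volume.withDensity fun x => ENNReal.ofReal (g x)) ∧
      ∀ (r : ℝ) (Ω₀ : Set (Space 2)), 0 < r → IsOpen Ω₀ → Ω₀ ⊆ ball 0 r →
        -- the kernel is square integrable on `Ω_T × Ω₀`
        MemLp (fun p : Space 2 × Space 2 => g (p.1 - p.2)) 2
          ((volume.restrict (ball 0 (r + c * T))).prod (volume.restrict Ω₀)) ∧
        ∃ F : Lp 𝕜 2 (volume.restrict Ω₀) →L[𝕜] Lp 𝕜 2 (volume.restrict (ball 0 (r + c * T))),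
          -- `F` is the forward operator `u ↦ v_{c,τ}(·, T)`
          (∀ (u : Space 2 → 𝕜) (hu : MemLp u 2 (volume.restrict Ω₀)),
            (ball 0 (r + c * T)).indicator (F (hu.toLp u)) =ᵐ[volume]
              causalDiffusion c τ (Ω₀.indicator u) T) ∧
          -- it is the integral operator with that kernel
          (∀ u : Lp 𝕜 2 (volume.restrict Ω₀),
            ∀ᵐ x ∂(volume.restrict (ball 0 (r + c * T))),
              F u x = ∫ x' in Ω₀, ((g (x - x') : ℝ) : 𝕜) * u x') ∧
          IsCompactOperator F := by
  have hT0 : 0 < T := by linarith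
  obtain ⟨g, hg, hg0, hg2, hgs, hG⟩ := exists_greenFunction hc hτ hT
  refine ⟨g, ⟨hg0, ⟨hg2, ?_⟩, hG⟩, fun r Ω₀ hr hΩ hΩr => ?_⟩
  · refine HasCompactSupport.intro (isCompact_closedBall 0 (c * T)) fun x hx => hgs x ?_
    simpa using hx
  have hvol : volume Ω₀ < ∞ := (measure_mono hΩr).trans_lt measure_ball_lt_top
  have hfin : IsFiniteMeasure ((volume : Measure (Space 2)).restrict Ω₀) := ⟨by simpa⟩
  have hK := memLp_two_comp_sub hg hg2 (ball 0 (r + c * T)) Ω₀ hvol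
  refine ⟨hK, ?_⟩
  obtain ⟨F, hF, hFc⟩ := exists_isCompactOperator_of_memLp_kernel (hK.ofReal (K := 𝕜))
  refine ⟨F, fun u hu => ?_, hF, hFc⟩
  -- Finite volume of `Ω₀` puts `L²` inside `L¹`, where the convolution representation applies.
  have hui : Integrable (Ω₀.indicator u) :=
    (integrable_indicator_iff hΩ.measurableSet).2 (hu.integrable one_le_two)
  have hFu := (ae_restrict_iff' measurableSet_ball).1 (hF (hu.toLp u))
  filter_upwards [causalDiffusion_ae_eq_integral_density hT0 hg hg0 hG hui, hFu] with x hx hFx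
  have hset : ∫ x', ((g (x - x') : ℝ) : 𝕜) * Ω₀.indicator u x' =
      ∫ x' in Ω₀, ((g (x - x') : ℝ) : 𝕜) * u x' := by
    rw [← integral_indicator hΩ.measurableSet]
    simp only [Set.indicator_mul_right]
  rw [hx, hset]
  by_cases hxb : x ∈ ball (0 : Space 2) (r + c * T)
  · rw [Set.indicator_of_mem hxb, hFx hxb]
    refine integral_congr_ae ?_
    filter_upwards [hu.coeFn_toLp] with x' hx'
    rw [hx']
  -- Outside the large ball every `x' ∈ Ω₀` has `‖x - x'‖ > c * T`, so the kernel vanishes.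
  · rw [Set.indicator_of_notMem hxb]
    symm
    refine setIntegral_eq_zero_of_forall_eq_zero fun x' hx' => ?_
    have h1 : ‖x'‖ < r := by simpa using hΩr hx'
    have h2 : r + c * T ≤ ‖x‖ := by simpa using hxb
    have h3 := norm_sub_norm_le x x'
    rw [hgs _ (by linarith), RCLike.ofReal_zero, zero_mul]
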